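/- Let $n\in\mathbb N$ and let $\mathbb R^n$ be equipped with the metric $d(u,u')=\|u-u'\|_1$. For $\varepsilon>0$, call a mechanism $Q$ (a map sending each $u\in\mathbb R^n$ to a probability distribution $Qu$ on a measurable space $\mathcal Y$ of responses) $\varepsilon$-private if $$\bigl|\ln\mathbb P(Qu\in S)-\ln\mathbb P(Qu'\in S)\bigr|\le\varepsilon\,\|u-u'\|_1\qquad\text{for all }u,u'\in\mathbb R^n\text{ and all measurable }S\subseteq\mathcal Y,$$ where it is understood that $\mathbb P(Qu\in S)$ and $\mathbb P(Qu'\in S)$ are either both zero or both positive. Then there exists a stochastic process $\{V_\varepsilon\}_{\varepsilon>0}$ with values in $\mathbb R^n$ such that the following hold. 1. **Structure.** The $n$ coordinate processes $\{V^{(i)}_\varepsilon\}_{\varepsilon>0}$ are independent and identically distributed, and each coordinate process $X_\varepsilon=V^{(i)}_\varepsilon$ is - Markov: for every $\varepsilon>0$, $\{X_\sigma\}_{\sigma\in(0,\varepsilon]}$ and $\{X_\sigma\}_{\sigma\in[\varepsilon,\infty)}$ are conditionally independent given $X_\varepsilon$; - Laplace distributed: $X_\varepsilon$ has density $\frac{\varepsilon}{2}e^{-\varepsilon|x|}$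 for every $\varepsilon>0$; - lazy: for $\varepsilon_2\ge\varepsilon_1>0$ the conditional distribution of $X_{\varepsilon_1}$ given $X_{\varepsilon_2}=y$ is $$\Bigl(\frac{\varepsilon_1}{\varepsilon_2}\Bigr)^2\delta(x-y)+\Bigl(1-\Bigl(\frac{\varepsilon_1}{\varepsilon_2}\Bigr)^2\Bigr)\frac{\varepsilon_1}{2}e^{-\varepsilon_1|x-y|},$$ where $\delta$ is the Dirac delta. 2. **Privacy.** For every $\varepsilon>0$, the mechanism that releases the whole path $\{u+V_\sigma\}_{\sigma\in(0,\varepsilon]}$ (a random element of $(\mathbb R^n)^{(0,\varepsilon]}$ with its product $\sigma$-algebra) is $\varepsilon$-private. 3. **Accuracy.** For every $\varepsilon>0$, the mechanism $Q_\varepsilon u=u+V_\varepsilon$ is an optimal $\varepsilon$-private mechanism: it is $\varepsilon$-private, and $\mathbb E\|V_\varepsilon\|_2^2\le\mathbb E\|V\|_2^2$ for every random vector $V$ in $\mathbb R^n$ for which the additive-noise mechanism $u\mapsto u+V$ is $\varepsilon$-private. -/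

import Mathlib

open MeasureTheory ProbabilityTheory

/-- The space `ℝⁿ` of private data, with the `ℓ₁` metric. -/
abbrev PrivateData (n : ℕ) : Type := PiLp 1 (fun _ : Fin n => ℝ)

/-- The privacy levels `ε ∈ (0, ∞)`. -/
abbrev PrivacyLevel : Type := Set.Ioi (0 : ℝ)

/-- `ε`-(Lipschitz) privacy of a mechanism `Q : U → Δ(Y)` on a metric space `U` of private data:
`|ln ℙ(Q u ∈ S) - ln ℙ(Q u' ∈ S)| ≤ ε * d(u, u')` for all `u`, `u'` and all measurable `S`.
Since `ln 0 = -∞`, the inequality includes that `ℙ(Q u ∈ S)` and `ℙ(Q u' ∈ S)` vanish together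
(in which case it imposes nothing more, and `Real.log 0 = 0` makes the second part trivial). -/
def IsLipschitzPrivate {U Y : Type*} [MetricSpace U] [MeasurableSpace Y]
    (ε : ℝ) (Q : U → Measure Y) : Prop :=
  (∀ u, IsProbabilityMeasure (Q u)) ∧
    ∀ (u u' : U) (S : Set Y), MeasurableSet S →
      (Q u S = 0 ↔ Q u' S = 0) ∧
        |Real.log ((Q u).real S) - Real.log ((Q u').real S)| ≤ ε * dist u u'

/-- The mechanism `u ↦ law of u + V` that adds noise `V` with law `g`. -/
noncomputable def additiveMechanism {n : ℕ} (g : Measure (PrivateData n)) :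
    PrivateData n → Measure (PrivateData n) :=
  fun u => g.map (fun v => u + v)

/-- The mean-squared error `𝔼 ‖V‖₂²` of noise `V` with law `g` (possibly infinite). -/
noncomputable def meanSquaredError {n : ℕ} (g : Measure (PrivateData n)) : ENNReal :=
  ∫⁻ v, ENNReal.ofReal (∑ i, (v i) ^ 2) ∂g

/-- Adding noise with law `g` is an optimal `ε`-private mechanism: it is `ε`-private, and its
mean-squared error is least among all `ε`-private mechanisms that add noise to the data. -/
def IsOptimalPrivateNoise {n : ℕ} (ε : ℝ) (g : Measure (PrivateData n)) : Prop :=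
  IsLipschitzPrivate ε (additiveMechanism g) ∧
    ∀ g' : Measure (PrivateData n), IsLipschitzPrivate ε (additiveMechanism g') →
      meanSquaredError g ≤ meanSquaredError g'

/-- The Laplace distribution with parameter `1 / ε`, of density `(ε / 2) * exp (-ε * |x|)`. -/
noncomputable def laplaceMeasure (ε : ℝ) : Measure ℝ :=
  volume.withDensity (fun x => ENNReal.ofReal (ε / 2 * Real.exp (-ε * |x|)))

/-- The distribution
`(ε₁/ε₂)² δ(x - y) + (1 - (ε₁/ε₂)²) (ε₁/2) exp (-ε₁ |x - y|)` of `x`, for given `y`. -/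
noncomputable def lazyTransition (ε₁ ε₂ y : ℝ) : Measure ℝ :=
  ENNReal.ofReal ((ε₁ / ε₂) ^ 2) • Measure.dirac y +
    ENNReal.ofReal (1 - (ε₁ / ε₂) ^ 2) • (laplaceMeasure ε₁).map (fun z => y + z)

/-- The Markov property of `X` under `P`: for every `t`, the past `σ(X s : s ≤ t)` and the future
`σ(X s : t ≤ s)` are conditionally independent given `X t`. -/
def IsMarkovProcess {ι Ω S : Type*} [Preorder ι] [MeasurableSpace Ω] [MeasurableSpace S]
    (X : ι → Ω → S) (P : Measure Ω) : Prop :=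
  ∀ (t : ι) (A B : Set Ω),
    MeasurableSet[⨆ s : Set.Iic t, MeasurableSpace.comap (X s) inferInstance] A →
    MeasurableSet[⨆ s : Set.Ici t, MeasurableSpace.comap (X s) inferInstance] B →
      P⟦A ∩ B | MeasurableSpace.comap (X t) inferInstance⟧ =ᵐ[P]
        P⟦A | MeasurableSpace.comap (X t) inferInstance⟧ *
          P⟦B | MeasurableSpace.comap (X t) inferInstance⟧

/-- A real process `X`, indexed by the privacy level, that is Markov, has Laplace marginals, and is
lazy: for `ε₁ ≤ ε₂` the conditional law of `X ε₁` given `X ε₂ = y` is `lazyTransition ε₁ ε₂ y`,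
which keeps the value `y` with positive probability. -/
structure IsLazyLaplaceProcess {Ω : Type*} [MeasurableSpace Ω]
    (X : PrivacyLevel → Ω → ℝ) (P : Measure Ω) [IsProbabilityMeasure P] : Prop where
  measurable : ∀ ε, Measurable (X ε)
  markov : IsMarkovProcess X P
  laplace : ∀ ε : PrivacyLevel, P.map (X ε) = laplaceMeasure ε
  lazy_transition : ∀ ε₁ ε₂ : PrivacyLevel, ε₁ ≤ ε₂ →
    ∀ᵐ y ∂(P.map (X ε₂)), condDistrib (X ε₁) (X ε₂) P y = lazyTransition ε₁ ε₂ y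

/-! The process runs downward in the privacy level. With p = (ε₁/ε₂)², the lazy noise p δ₀ + (1 - p)
Laplace(ε₁) has characteristic function (1 + t²/ε₂²)/(1 + t²/ε₁²), the quotient of two Laplace
characteristic functions (`charFun_lazyNoise`). So adding independent lazy noise to a Laplace
variable of level ε₂ gives one of level ε₁, and chaining such steps gives a process whose increments
toward lower levels are independent. The increment arriving at a level carries the total coefficient
of that level and all lower ones. Grouping the factors by level gives the product `fddChar`. These
laws are consistent (`fddChar_eq_of_subset`), so Kolmogorov's theorem (`exists_isProjectiveLimit`)
gives one coordinate process; `n` independent copies form `V`.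

Everything structural follows from `HasLazyLaplaceLaws.indepFun_increments`: the values at levels ≥
ε are independent of the increments below ε. This gives the Markov property and the transition law.
It also gives privacy: the path up to ε is a function of its endpoint and independent increments, so
releasing it costs no more than releasing u + X_ε, and the coordinate costs add up to the ℓ₁
distance.

For accuracy, shifting half-lines shows that each coordinate of ε-private noise satisfies P(|Vᵢ| ≥
r) ≥ exp(-εr) (`IsLipschitzPrivate.exp_neg_le_measure_le_abs`), with equality for Laplace noise.
Integrating tails compares the second moments. -/

open Filter Topology Set
open scoped ENNReal

/-! ### Kolmogorov extension over an arbitrary index set -/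

section KolmogorovExtension

variable {ι E : Type*} [TopologicalSpace E]

/-- A sequence of cylinders with compact bases has a common point as soon as each finite
intersection has one. -/
lemma nonempty_iInter_compact_cylinders [T2Space E] [Nonempty E] (J : ℕ → Finset ι)
    (K : ∀ n, Set (J n → E)) (hK : ∀ n, IsCompact (K n))
    (x : ℕ → ι → E) (hx : ∀ n, ∀ k ≤ n, (J k).restrict (x n) ∈ K k) :
    ∃ y : ι → E, ∀ k, (J k).restrict y ∈ K k := by
  classical
  -- An ultrafilter finer than `atTop` replaces a diagonal subsequence: all restrictions converge
  -- along it.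
  let F : Ultrafilter ℕ := Ultrafilter.of atTop
  have hF : (F : Filter ℕ) ≤ atTop := Ultrafilter.of_le _
  have hlim : ∀ k, ∃ z ∈ K k, Tendsto (fun n => (J k).restrict (x n)) F (𝓝 z) := by
    intro k
    have := (hK k).ultrafilter_le_nhds (F.map (fun n => (J k).restrict (x n))) (by
      rw [le_principal_iff]
      exact hF ((eventually_ge_atTop k).mono fun n hn => hx n k hn))
    exact this
  choose z hzK hz using hlim
  have hcoord : ∀ k, ∀ i : J k, Tendsto (fun n => x n i) F (𝓝 (z k i)) := fun k i =>
    (tendsto_pi_nhds.1 (hz k)) i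
  -- Uniqueness of limits makes the limits `z k` agree on shared coordinates; elsewhere the value is
  -- irrelevant.
  let y : ι → E := fun i => if h : ∃ l, Tendsto (fun n => x n i) F (𝓝 l) then h.choose
    else Classical.arbitrary E
  refine ⟨y, fun k => ?_⟩
  suffices (J k).restrict y = z k from this ▸ hzK k
  ext i
  have h : ∃ l, Tendsto (fun n => x n i) F (𝓝 l) := ⟨_, hcoord k i⟩
  have hy : y i = h.choose := dif_pos h
  change y i = _
  rw [hy]
  exact tendsto_nhds_unique h.choose_spec (hcoord k i)

variable [PolishSpace E] [MeasurableSpace E] [BorelSpace E]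
  {P : ∀ J : Finset ι, Measure (∀ _ : J, E)} [∀ J, IsProbabilityMeasure (P J)]

/-- Inner regularity: if the contents stayed above δ, compact sets inside the bases could be chosen
with total loss below δ. Finite intersections of the compact cylinders would then meet, and
compactness would put a point in every `s n`. -/
lemma projectiveFamilyContent_tendsto_zero (hP : IsProjectiveMeasureFamily (α := fun _ : ι => E) P)
    {s : ℕ → Set (ι → E)} (hs : ∀ n, s n ∈ measurableCylinders (fun _ : ι => E))
    (hanti : Antitone s) (hempty : ⋂ n, s n = ∅) :
    Tendsto (fun n => projectiveFamilyContent hP (s n)) atTop (𝓝 0) := by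
  let := TopologicalSpace.upgradeIsCompletelyMetrizable E
  have hmono : Antitone (fun n => projectiveFamilyContent hP (s n)) := fun m n hmn =>
    projectiveFamilyContent_mono hP (hs n) (hs m) (hanti hmn)
  rw [show (0 : ℝ≥0∞) = ⨅ n, projectiveFamilyContent hP (s n) from ?_]
  · exact tendsto_atTop_iInf hmono
  by_contra hne
  obtain ⟨δ, hδ0, hδ⟩ := exists_between (pos_iff_ne_zero.2 (Ne.symm hne))
  have hδs : ∀ n, δ < projectiveFamilyContent hP (s n) := fun n => hδ.trans_le (iInf_le _ n)
  obtain ⟨δ', hδ'0, hδ'⟩ := ENNReal.exists_pos_sum_of_countable' hδ0.ne' ℕ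
  choose J S hSm hsS using fun n => (mem_measurableCylinders (s n)).1 (hs n)
  have hK : ∀ n, ∃ K ⊆ S n, IsCompact K ∧ P (J n) (S n \ K) < δ' n := by
    intro n
    obtain ⟨K, hKS, hKc, hK⟩ := (hSm n).exists_isCompact_sdiff_lt (μ := P (J n))
      (measure_ne_top _ _) (hδ'0 n).ne'
    exact ⟨K, hKS, hKc, hK⟩
  choose K hKS hKc hKlt using hK
  have hKm : ∀ n, MeasurableSet (K n) := fun n => (hKc n).isClosed.measurableSet
  have hne : ∀ n, ∃ x ∈ s n, ∀ k ≤ n, (J k).restrict x ∈ K k := by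
    intro n
    by_contra! hcon
    have hsub : s n ⊆ ⋃ k ≤ n, (cylinder (J k) (S k \ K k) : Set (ι → E)) := by
      intro x hx
      obtain ⟨k, hk, hxk⟩ := hcon x hx
      have hxs : x ∈ s k := hanti hk hx
      rw [hsS k] at hxs
      exact mem_iUnion₂.2 ⟨k, hk, hxs, hxk⟩
    have hcyl : ∀ k, (cylinder (J k) (S k \ K k) : Set (ι → E)) ∈
        measurableCylinders (fun _ : ι => E) := fun k =>
      cylinder_mem_measurableCylinders _ _ ((hSm k).diff (hKm k))
    have hU : (⋃ k ≤ n, (cylinder (J k) (S k \ K k) : Set (ι → E))) ∈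
        measurableCylinders (fun _ : ι => E) := by
      have := isSetRing_measurableCylinders (α := fun _ : ι => E) |>.biUnion_mem
        (Finset.range (n + 1)) (fun k _ => hcyl k)
      simpa only [Finset.mem_range_succ_iff] using this
    have := calc δ < projectiveFamilyContent hP (s n) := hδs n
      _ ≤ projectiveFamilyContent hP (⋃ k ≤ n, (cylinder (J k) (S k \ K k) : Set (ι → E))) :=
        projectiveFamilyContent_mono hP (hs n) hU hsub
      _ ≤ ∑ k ∈ Finset.range (n + 1), projectiveFamilyContent hP (cylinder (J k) (S k \ K k)) :=
        projectiveFamilyContent_iUnion_le hP hcyl n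
      _ ≤ ∑ k ∈ Finset.range (n + 1), δ' k := by
        gcongr with k _
        rw [projectiveFamilyContent_cylinder hP ((hSm k).diff (hKm k))]
        exact (hKlt k).le
      _ ≤ ∑' k, δ' k := ENNReal.sum_le_tsum _
    exact (this.trans hδ').false
  choose x hxs hx using hne
  have hE : Nonempty E ∨ IsEmpty ι := by
    rcases isEmpty_or_nonempty ι with h | ⟨⟨i⟩⟩
    · exact Or.inr h
    · exact Or.inl ⟨x 0 i⟩
  have : ∃ y : ι → E, ∀ k, (J k).restrict y ∈ K k := by
    rcases hE with hE | hE
    · exact nonempty_iInter_compact_cylinders J K hKc x hx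
    · refine ⟨x 0, fun k => ?_⟩
      rw [Subsingleton.elim (x 0) (x k)]
      exact hx k k le_rfl
  obtain ⟨y, hy⟩ := this
  have : y ∈ ⋂ n, s n := mem_iInter.2 fun n => by
    rw [hsS n]
    exact hKS n (hy n)
  simp [hempty] at this

/-- **Kolmogorov's extension theorem** for a projective family of probability measures on the
finite powers of a Polish space. -/
theorem exists_isProjectiveLimit (hP : IsProjectiveMeasureFamily (α := fun _ : ι => E) P) :
    ∃ μ : Measure (ι → E), IsProbabilityMeasure μ ∧
      IsProjectiveLimit (α := fun _ : ι => E) μ P := by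
  have hsub : (projectiveFamilyContent hP).IsSigmaSubadditive := by
    refine isSigmaSubadditive_of_addContent_iUnion_eq_tsum
      isSetRing_measurableCylinders (fun f hf hf_Union hf' => ?_)
    exact addContent_iUnion_eq_sum_of_tendsto_zero isSetRing_measurableCylinders
      (projectiveFamilyContent hP) (fun s hs => projectiveFamilyContent_ne_top hP)
      (fun _ => projectiveFamilyContent_tendsto_zero hP) hf hf_Union hf'
  let μ : Measure (ι → E) := (projectiveFamilyContent hP).measure isSetSemiring_measurableCylinders
      generateFrom_measurableCylinders.ge hsub
  have hμ : IsProjectiveLimit (α := fun _ : ι => E) μ P := by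
    intro I
    ext s hs
    rw [Measure.map_apply (by fun_prop) hs, AddContent.measure_eq, ← cylinder,
      projectiveFamilyContent_cylinder hP hs]
    · exact generateFrom_measurableCylinders.symm
    · exact cylinder_mem_measurableCylinders _ _ hs
  exact ⟨μ, hμ.isProbabilityMeasure, hμ⟩

end KolmogorovExtension

/-! ### The Laplace distribution: characteristic function, tails, shifts -/

section Laplace

lemma integrable_exp_neg_mul_abs_mul_cexp {ε : ℝ} (hε : 0 < ε) (t : ℝ) :
    IntegrableOn (fun x : ℝ => (Real.exp (-ε * |x|) : ℂ) * Complex.exp (t * x * Complex.I))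
      (Iic 0) ∧
    IntegrableOn (fun x : ℝ => (Real.exp (-ε * |x|) : ℂ) * Complex.exp (t * x * Complex.I))
      (Ioi 0) ∧
    (∫ x : ℝ in Iic 0, (Real.exp (-ε * |x|) : ℂ) * Complex.exp (t * x * Complex.I)) =
      1 / (ε + t * Complex.I) ∧
    (∫ x : ℝ in Ioi 0, (Real.exp (-ε * |x|) : ℂ) * Complex.exp (t * x * Complex.I)) =
      1 / (ε - t * Complex.I) := by
  have h1 : EqOn (fun x : ℝ => (Real.exp (-ε * |x|) : ℂ) * Complex.exp (t * x * Complex.I))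
      (fun x : ℝ => Complex.exp ((ε + t * Complex.I) * x)) (Iic 0) := by
    intro x hx
    simp only [abs_of_nonpos (mem_Iic.1 hx), Complex.ofReal_exp, ← Complex.exp_add]
    congr 1
    push_cast
    ring
  have h2 : EqOn (fun x : ℝ => (Real.exp (-ε * |x|) : ℂ) * Complex.exp (t * x * Complex.I))
      (fun x : ℝ => Complex.exp ((-ε + t * Complex.I) * x)) (Ioi 0) := by
    intro x hx
    simp only [abs_of_pos (mem_Ioi.1 hx), Complex.ofReal_exp, ← Complex.exp_add]
    congr 1
    push_cast
    ring
  have r1 : 0 < ((ε + t * Complex.I : ℂ)).re := by simpa using hε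
  have r2 : ((-ε + t * Complex.I : ℂ)).re < 0 := by simpa using hε
  refine ⟨(integrableOn_congr_fun h1 measurableSet_Iic).2 (integrableOn_exp_mul_complex_Iic r1 0),
    (integrableOn_congr_fun h2 measurableSet_Ioi).2 (integrableOn_exp_mul_complex_Ioi r2 0), ?_, ?_⟩
  · rw [setIntegral_congr_fun measurableSet_Iic h1, integral_exp_mul_complex_Iic r1]
    simp
  · rw [setIntegral_congr_fun measurableSet_Ioi h2, integral_exp_mul_complex_Ioi r2]
    rw [show (ε - t * Complex.I : ℂ) = -(-ε + t * Complex.I) by ring, div_neg]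
    simp [neg_div]

/-- The characteristic function `1 / (1 + s²)` of the Laplace distribution of parameter `1`. -/
noncomputable def laplaceChar (s : ℝ) : ℂ := ((1 + s ^ 2)⁻¹ : ℝ)

@[simp]
lemma laplaceChar_zero : laplaceChar 0 = 1 := by simp [laplaceChar]

lemma laplaceChar_ne_zero (s : ℝ) : laplaceChar s ≠ 0 := by
  have : (0 : ℝ) < 1 + s ^ 2 := by positivity
  simpa only [laplaceChar, ne_eq, Complex.ofReal_eq_zero, inv_eq_zero] using this.ne'

lemma charFun_laplaceMeasure {ε : ℝ} (hε : 0 < ε) (t : ℝ) :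
    charFun (laplaceMeasure ε) t = laplaceChar (t / ε) := by
  obtain ⟨i1, i2, e1, e2⟩ := integrable_exp_neg_mul_abs_mul_cexp hε t
  rw [charFun_apply_real, laplaceMeasure,
    integral_withDensity_eq_integral_toReal_smul (by fun_prop) (by simp)]
  have : ∀ x : ℝ, (ENNReal.ofReal (ε / 2 * Real.exp (-ε * |x|))).toReal •
      Complex.exp (t * x * Complex.I) =
      (ε / 2 : ℂ) * ((Real.exp (-ε * |x|) : ℂ) * Complex.exp (t * x * Complex.I)) := by
    intro x
    rw [ENNReal.toReal_ofReal (by positivity), Complex.real_smul]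
    push_cast
    ring
  simp_rw [this]
  rw [integral_const_mul, ← intervalIntegral.integral_Iic_add_Ioi i1 i2, e1, e2, laplaceChar]
  have h3 : (ε + t * Complex.I : ℂ) ≠ 0 := fun h => hε.ne' (by simpa using congrArg Complex.re h)
  have h4 : (ε - t * Complex.I : ℂ) ≠ 0 := fun h => hε.ne' (by simpa using congrArg Complex.re h)
  have h5 : (ε : ℂ) ≠ 0 := by exact_mod_cast hε.ne'
  have h6 : (1 + (t / ε) ^ 2 : ℂ) = (ε + t * Complex.I) * (ε - t * Complex.I) / ε ^ 2 := by
    field_simp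
    linear_combination (t : ℂ) ^ 2 * Complex.I_sq
  push_cast
  rw [h6]
  field_simp
  ring

lemma laplaceMeasure_le_abs {ε : ℝ} (hε : 0 < ε) {r : ℝ} (hr : 0 ≤ r) :
    laplaceMeasure ε {x | r ≤ |x|} = ENNReal.ofReal (Real.exp (-(ε * r))) := by
  have hI : laplaceMeasure ε (Ioi r) = ENNReal.ofReal (Real.exp (-(ε * r)) / 2) := by
    rw [laplaceMeasure, withDensity_apply _ measurableSet_Ioi]
    have h2 : EqOn (fun x : ℝ => ENNReal.ofReal (ε / 2 * Real.exp (-ε * |x|)))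
      (fun x : ℝ => ENNReal.ofReal (ε / 2 * Real.exp (-ε * x))) (Ioi r) := by
      intro x hx
      simp only [abs_of_pos (hr.trans_lt (mem_Ioi.1 hx))]
    rw [setLIntegral_congr_fun measurableSet_Ioi h2, ← ofReal_integral_eq_lintegral_ofReal
      ((integrableOn_exp_mul_Ioi (by linarith) r).const_mul _)
      (Eventually.of_forall fun x => by positivity), integral_const_mul,
      integral_exp_mul_Ioi (by linarith)]
    congr 1
    rw [neg_mul]
    field_simp
  have hJ : laplaceMeasure ε (Iic (-r)) = ENNReal.ofReal (Real.exp (-(ε * r)) / 2) := by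
    rw [laplaceMeasure, withDensity_apply _ measurableSet_Iic]
    have h2 : EqOn (fun x : ℝ => ENNReal.ofReal (ε / 2 * Real.exp (-ε * |x|)))
      (fun x : ℝ => ENNReal.ofReal (ε / 2 * Real.exp (ε * x))) (Iic (-r)) := by
      intro x hx
      have : x ≤ 0 := (mem_Iic.1 hx).trans (by linarith)
      simp only [abs_of_nonpos this, neg_mul_neg]
    rw [setLIntegral_congr_fun measurableSet_Iic h2, ← ofReal_integral_eq_lintegral_ofReal
      ((integrableOn_exp_mul_Iic (by linarith) _).const_mul _)
      (Eventually.of_forall fun x => by positivity), integral_const_mul,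
      integral_exp_mul_Iic (by linarith)]
    congr 1
    rw [mul_neg]
    field_simp
  -- Dropping the null point `r` makes the two half-lines disjoint even when r = 0.
  have hK : laplaceMeasure ε {x | r ≤ |x|} = laplaceMeasure ε (Iic (-r) ∪ Ioi r) := by
    refine measure_congr ?_
    have hac : laplaceMeasure ε ≪ volume := withDensity_absolutelyContinuous _ _
    have : ∀ᵐ x ∂(laplaceMeasure ε), x ≠ r := by
      refine hac.ae_le ?_
      change volume {x | x ≠ r}ᶜ = 0
      simp
    filter_upwards [this] with x hx
    apply propext
    change r ≤ |x| ↔ x ≤ -r ∨ r < x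
    rw [le_abs', lt_iff_le_and_ne]
    exact or_congr_right ⟨fun h => ⟨h, hx.symm⟩, fun h => h.1⟩
  rcases eq_or_lt_of_le hr with rfl | hr'
  · rw [hK, measure_union (by simp) measurableSet_Ioi, hI, hJ,
      ← ENNReal.ofReal_add (by positivity) (by positivity), add_halves]
  · rw [hK, measure_union (Set.disjoint_left.2 fun x hx hx' => by
      simp only [mem_Iic, mem_Ioi] at hx hx'; linarith) measurableSet_Ioi, hI, hJ,
      ← ENNReal.ofReal_add (by positivity) (by positivity), add_halves]

lemma isProbabilityMeasure_laplaceMeasure {ε : ℝ} (hε : 0 < ε) :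
    IsProbabilityMeasure (laplaceMeasure ε) := by
  constructor
  have := laplaceMeasure_le_abs hε le_rfl
  simpa using this

/-- Layer-cake formula for the second moment. -/
lemma lintegral_sq_eq_lintegral_tail (μ : Measure ℝ) [SFinite μ] :
    ∫⁻ x, ENNReal.ofReal (x ^ 2) ∂μ =
      ∫⁻ t in Ioi (0 : ℝ), μ {x | t ≤ |x|} * ENNReal.ofReal (2 * t) := by
  rw [← lintegral_comp_eq_lintegral_meas_le_mul_of_measurable_of_sigmaFinite μ
    (f := fun x => |x|) (g := fun t => 2 * t) (fun x => abs_nonneg x) (by fun_prop)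
    (fun t _ => (by fun_prop : Continuous fun t : ℝ => 2 * t).intervalIntegrable _ _)
    (by fun_prop) (fun t ht => by positivity)]
  congr with x
  rw [intervalIntegral.integral_const_mul, integral_id]
  congr 1
  rw [← sq_abs]
  ring

/-- The triangle inequality bounds the ratio of the shifted densities. Privacy as domination of
measures passes to products and images. -/
lemma map_const_add_laplaceMeasure_le {ε : ℝ} (hε : 0 < ε) (u u' : ℝ) :
    (laplaceMeasure ε).map (fun x => u + x) ≤
      ENNReal.ofReal (Real.exp (ε * |u - u'|)) • (laplaceMeasure ε).map (fun x => u' + x) := by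
  have h : ∀ u : ℝ, (laplaceMeasure ε).map (fun x => u + x) =
      volume.withDensity (fun x => ENNReal.ofReal (ε / 2 * Real.exp (-ε * |x - u|))) := by
    intro u
    ext s hs
    rw [Measure.map_apply (by fun_prop) hs, laplaceMeasure,
      withDensity_apply _ ((measurable_const_add u) hs), withDensity_apply _ hs,
      ← lintegral_indicator ((measurable_const_add u) hs), ← lintegral_indicator hs]
    conv_rhs => rw [← lintegral_add_left_eq_self _ u]
    congr with x
    simp only [indicator, mem_preimage, add_sub_cancel_left]
    rfl
  rw [h, h, ← withDensity_smul _ (by fun_prop)]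
  refine withDensity_mono (Eventually.of_forall fun x => ?_)
  simp only [Pi.smul_apply, smul_eq_mul]
  rw [← ENNReal.ofReal_mul (by positivity)]
  refine ENNReal.ofReal_le_ofReal ?_
  rw [mul_left_comm, ← Real.exp_add]
  gcongr
  have : |x - u'| ≤ |x - u| + |u - u'| := abs_sub_le x u u'
  nlinarith

end Laplace

/-! ### The noise added when passing to a lower level -/

section LazyNoise

/-- The law of the increment of the lazy Laplace process between the levels `ε₂` and `ε₁ ≤ ε₂`. -/
noncomputable def lazyNoise (ε₁ ε₂ : ℝ) : Measure ℝ :=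
  ENNReal.ofReal ((ε₁ / ε₂) ^ 2) • Measure.dirac 0 +
    ENNReal.ofReal (1 - (ε₁ / ε₂) ^ 2) • laplaceMeasure ε₁

lemma lazyTransition_eq_map (ε₁ ε₂ y : ℝ) :
    lazyTransition ε₁ ε₂ y = (lazyNoise ε₁ ε₂).map (fun z => y + z) := by
  rw [lazyNoise, Measure.map_add _ _ (by fun_prop), Measure.map_smul, Measure.map_smul,
    Measure.map_dirac' (by fun_prop), add_zero, lazyTransition]

variable {ε₁ ε₂ : ℝ}

lemma div_sq_le_one (h₁ : 0 < ε₁) (h : ε₁ ≤ ε₂) : (ε₁ / ε₂) ^ 2 ≤ 1 :=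
  pow_le_one₀ (div_nonneg h₁.le (h₁.le.trans h)) ((div_le_one (h₁.trans_le h)).2 h)

lemma isProbabilityMeasure_lazyNoise (h₁ : 0 < ε₁) (h : ε₁ ≤ ε₂) :
    IsProbabilityMeasure (lazyNoise ε₁ ε₂) := by
  have := isProbabilityMeasure_laplaceMeasure h₁
  constructor
  simp only [lazyNoise, Measure.coe_add, Measure.coe_smul, Pi.add_apply, Pi.smul_apply,
    measure_univ, smul_eq_mul, mul_one]
  rw [← ENNReal.ofReal_add (by positivity) (by linarith [div_sq_le_one h₁ h]),
    add_sub_cancel, ENNReal.ofReal_one]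

lemma charFun_lazyNoise (h₁ : 0 < ε₁) (h : ε₁ ≤ ε₂) (t : ℝ) :
    charFun (lazyNoise ε₁ ε₂) t = laplaceChar (t / ε₁) / laplaceChar (t / ε₂) := by
  have := isProbabilityMeasure_laplaceMeasure h₁
  have h₂ : 0 < ε₂ := h₁.trans_le h
  have hint : ∀ μ : Measure ℝ, [IsProbabilityMeasure μ] → Integrable
      (fun x : ℝ => Complex.exp (t * x * Complex.I)) μ := fun μ _ =>
    Integrable.of_bound (by fun_prop) 1 (Eventually.of_forall fun x => by
      rw [← Complex.ofReal_mul, Complex.norm_exp_ofReal_mul_I])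
  rw [charFun_apply_real, lazyNoise, integral_add_measure
    ((hint _).smul_measure ENNReal.ofReal_ne_top) ((hint _).smul_measure ENNReal.ofReal_ne_top),
    integral_smul_measure, integral_smul_measure, ← charFun_apply_real, ← charFun_apply_real,
    charFun_laplaceMeasure h₁, charFun_dirac, ENNReal.toReal_ofReal (by positivity),
    ENNReal.toReal_ofReal (by linarith [div_sq_le_one h₁ h])]
  simp only [laplaceChar, Complex.real_smul, inner_zero_left, Complex.ofReal_zero, zero_mul,
    Complex.exp_zero, mul_one]
  norm_cast
  have h₃ : 0 < ε₁ ^ 2 + t ^ 2 := by positivity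
  have h₄ : 0 < ε₂ ^ 2 + t ^ 2 := by positivity
  field_simp
  ring

end LazyNoise

/-! ### Consistent finite-dimensional laws and existence of the process -/

section FiniteDimensionalLaws

/-- The characteristic function of the law of a lazy Laplace process at the levels in `J`. -/
noncomputable def fddChar (J : Finset PrivacyLevel) (c : PrivacyLevel → ℝ) : ℂ :=
  ∏ e ∈ J, laplaceChar ((∑ f ∈ J with f ≤ e, c f) / e) /
    laplaceChar ((∑ f ∈ J with f < e, c f) / e)

/-- At a level outside `I` the sums over `≤` and `<` coincide, so its factor is 1. This is the
projective consistency of the laws. -/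
lemma fddChar_eq_of_subset {I J : Finset PrivacyLevel} (h : I ⊆ J) {c : PrivacyLevel → ℝ}
    (hc : ∀ e ∈ J, e ∉ I → c e = 0) : fddChar J c = fddChar I c := by
  have hs : ∀ p : PrivacyLevel → Prop, [DecidablePred p] →
      ∑ f ∈ J with p f, c f = ∑ f ∈ I with p f, c f := by
    intro p _
    refine (Finset.sum_subset (Finset.filter_subset_filter _ h) fun e he he' => ?_).symm
    simp only [Finset.mem_filter, not_and'] at he he'
    exact hc e he.1 (he' he.2)
  rw [fddChar, fddChar]
  simp_rw [hs]
  refine (Finset.prod_subset h fun e he he' => ?_).symm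
  have : ∑ f ∈ I with f ≤ e, c f = ∑ f ∈ I with f < e, c f := by
    refine Finset.sum_congr (Finset.filter_congr fun f hf => ?_) fun _ _ => rfl
    exact ⟨fun hfe => lt_of_le_of_ne hfe fun h => he' (h ▸ hf), le_of_lt⟩
  rw [this, div_self (laplaceChar_ne_zero _)]

lemma fddChar_singleton (e : PrivacyLevel) (c : PrivacyLevel → ℝ) :
    fddChar {e} c = laplaceChar (c e / e) := by
  simp [fddChar, Finset.filter_singleton]

/-- Mirrors X_f = X_m + increment at a new lowest level: the coefficient of `f` moves onto `m`, and
the independent increment contributes the lazy-noise factor. -/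
lemma fddChar_insert_min {s : Finset PrivacyLevel} {f m : PrivacyLevel} (hm : m ∈ s)
    (hms : ∀ e ∈ s, m ≤ e) (hf : f < m) (c : PrivacyLevel → ℝ) :
    fddChar (insert f s) c = fddChar s (c + Pi.single m (c f)) *
      (laplaceChar (c f / f) / laplaceChar (c f / m)) := by
  have hfs : f ∉ s := fun h => (hms f h).not_gt hf
  rw [fddChar, Finset.prod_insert hfs, fddChar, ← Finset.mul_prod_erase s _ hm,
    ← Finset.mul_prod_erase s _ hm]
  have hlt : ∀ e ∈ s, f < e := fun e he => hf.trans_le (hms e he)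
  have e1 : ∀ e, f ≤ e → ∑ g ∈ insert f s with g ≤ e, c g = c f + ∑ g ∈ s with g ≤ e, c g := by
    intro e he
    rw [Finset.filter_insert, if_pos he, Finset.sum_insert (by simp [hfs])]
  have e2 : ∀ e, f < e → ∑ g ∈ insert f s with g < e, c g = c f + ∑ g ∈ s with g < e, c g := by
    intro e he
    rw [Finset.filter_insert, if_pos he, Finset.sum_insert (by simp [hfs])]
  have e3 : ∀ e, m ≤ e → ∑ g ∈ s with g ≤ e, (c + Pi.single m (c f) : PrivacyLevel → ℝ) g =
      c f + ∑ g ∈ s with g ≤ e, c g := by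
    intro e he
    simp [Finset.sum_add_distrib, hm, he, add_comm]
  have e4 : ∀ e, m < e → ∑ g ∈ s with g < e, (c + Pi.single m (c f) : PrivacyLevel → ℝ) g =
      c f + ∑ g ∈ s with g < e, c g := by
    intro e he
    simp [Finset.sum_add_distrib, hm, he, add_comm]
  have e5 : (s.filter fun g => g < m) = ∅ :=
    Finset.filter_eq_empty_iff.2 fun g hg => (hms g hg).not_gt
  have e6 : (s.filter fun g => g ≤ f) = ∅ :=
    Finset.filter_eq_empty_iff.2 fun g hg => (hlt g hg).not_ge
  have e7 : (s.filter fun g => g < f) = ∅ :=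
    Finset.filter_eq_empty_iff.2 fun g hg => (hlt g hg).not_gt
  have hprod : ∏ e ∈ s.erase m, laplaceChar ((∑ g ∈ insert f s with g ≤ e, c g) / e) /
      laplaceChar ((∑ g ∈ insert f s with g < e, c g) / e) =
      ∏ e ∈ s.erase m, laplaceChar
        ((∑ g ∈ s with g ≤ e, (c + Pi.single m (c f) : PrivacyLevel → ℝ) g) / e) /
      laplaceChar ((∑ g ∈ s with g < e, (c + Pi.single m (c f) : PrivacyLevel → ℝ) g) / e) := by
    refine Finset.prod_congr rfl fun e he => ?_
    rw [Finset.mem_erase] at he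
    have hme : m < e := lt_of_le_of_ne (hms e he.2) he.1.symm
    rw [e1 e (hf.trans hme).le, e2 e (hf.trans hme), e3 e hme.le, e4 e hme]
  rw [hprod, e1 m hf.le, e2 m hf, e3 m le_rfl, e5, e1 f le_rfl, e6,
    Finset.filter_insert, if_neg (lt_irrefl f), e7]
  simp only [Finset.sum_empty, add_zero, zero_div, laplaceChar_zero, div_one]
  ring

/-- The process `X` has the finite-dimensional laws of a lazy Laplace process. -/
structure HasLazyLaplaceLaws {Ω : Type*} [MeasurableSpace Ω]
    (X : PrivacyLevel → Ω → ℝ) (P : Measure Ω) : Prop where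
  measurable : ∀ e, Measurable (X e)
  integral_cexp : ∀ (J : Finset PrivacyLevel) (c : PrivacyLevel → ℝ),
    ∫ ω, Complex.exp ((∑ e ∈ J, c e * X e ω : ℝ) * Complex.I) ∂P = fddChar J c

/-- Induction by adding a lowest level `f`, whose value is that at the next level `m` plus
independent lazy noise. Coordinates outside `J` are arbitrary; using the full function space avoids
changing index types. -/
lemma exists_measure_fddChar (J : Finset PrivacyLevel) :
    ∃ μ : Measure (PrivacyLevel → ℝ), IsProbabilityMeasure μ ∧ ∀ c : PrivacyLevel → ℝ,
      ∫ x, Complex.exp ((∑ e ∈ J, c e * x e : ℝ) * Complex.I) ∂μ = fddChar J c := by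
  induction J using Finset.induction_on_min with
  | empty => exact ⟨Measure.dirac 0, inferInstance, fun c => by simp [fddChar]⟩
  | insert f s hfs ih =>
    obtain ⟨μ, hμ, hμc⟩ := ih
    have hf : f ∉ s := fun h => (hfs f h).false
    rcases s.eq_empty_or_nonempty with rfl | hs
    · have := isProbabilityMeasure_laplaceMeasure f.2
      have hm : Measurable fun (z : ℝ) (_ : PrivacyLevel) => z := by fun_prop
      refine ⟨(laplaceMeasure f).map fun z _ => z,
        Measure.isProbabilityMeasure_map hm.aemeasurable, fun c => ?_⟩
      rw [integral_map hm.aemeasurable (Measurable.aestronglyMeasurable (by fun_prop)),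
        insert_empty_eq, fddChar_singleton,
        ← charFun_laplaceMeasure f.2, charFun_apply_real]
      simp
    · obtain ⟨m, hm, hms⟩ : ∃ m ∈ s, ∀ e ∈ s, m ≤ e :=
        ⟨s.min' hs, s.min'_mem hs, fun e he => s.min'_le e he⟩
      have hfm := hfs m hm
      have := isProbabilityMeasure_lazyNoise f.2 hfm.le
      have hmeas : Measurable fun p : (PrivacyLevel → ℝ) × ℝ =>
          Function.update p.1 f (p.1 m + p.2) := by
        refine measurable_pi_iff.2 fun e => ?_
        by_cases he : e = f
        · subst he
          simp only [Function.update_self]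
          fun_prop
        · simp only [Function.update_of_ne he]
          fun_prop
      refine ⟨(μ.prod (lazyNoise f m)).map fun p => Function.update p.1 f (p.1 m + p.2),
        Measure.isProbabilityMeasure_map hmeas.aemeasurable, fun c => ?_⟩
      rw [integral_map hmeas.aemeasurable (Measurable.aestronglyMeasurable (by fun_prop)),
        fddChar_insert_min hm hms hfm,
        ← charFun_lazyNoise f.2 hfm.le, ← hμc, charFun_apply_real, ← integral_prod_mul]
      refine integral_congr_ae (Eventually.of_forall fun p => ?_)
      simp only
      rw [← Complex.exp_add, Finset.sum_insert hf]
      congr 1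
      have h1 : ∑ e ∈ s, c e * Function.update p.1 f (p.1 m + p.2) e = ∑ e ∈ s, c e * p.1 e :=
        Finset.sum_congr rfl fun e he => by
          rw [Function.update_of_ne (ne_of_mem_of_not_mem he hf)]
      have h2 : ∑ e ∈ s, (c + Pi.single m (c f) : PrivacyLevel → ℝ) e * p.1 e =
          ∑ e ∈ s, c e * p.1 e + c f * p.1 m := by
        simp only [Pi.add_apply, add_mul, Finset.sum_add_distrib]
        congr 1
        rw [Finset.sum_eq_single m]
        · simp
        · intro e _ he
          simp [he]
        · exact fun h => absurd hm h
      rw [h1, h2, Function.update_self]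
      push_cast
      ring

lemma strongDual_pi_apply {J : Type*} [Fintype J] [DecidableEq J] (L : StrongDual ℝ (J → ℝ))
    (x : J → ℝ) :
    L x = ∑ j, L (fun i => if j = i then 1 else 0) * x j := by
  have := LinearMap.pi_apply_eq_sum_univ (L : (J → ℝ) →ₗ[ℝ] ℝ) x
  simp only [ContinuousLinearMap.coe_coe, smul_eq_mul] at this
  rw [this]
  refine Finset.sum_congr rfl fun j _ => ?_
  rw [mul_comm]

lemma charFunDual_map_restrict {Ω : Type*} [MeasurableSpace Ω] {P : Measure Ω}
    {X : PrivacyLevel → Ω → ℝ} (hX : ∀ e, Measurable (X e)) (J : Finset PrivacyLevel)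
    (L : StrongDual ℝ (J → ℝ)) :
    charFunDual (P.map fun ω (e : J) => X e ω) L =
      ∫ ω, Complex.exp ((∑ e ∈ J, (if h : e ∈ J then
        L (fun i => if ⟨e, h⟩ = i then 1 else 0) else 0) * X e ω : ℝ) * Complex.I) ∂P := by
  rw [charFunDual_apply, integral_map (by fun_prop) (by fun_prop)]
  congr with ω
  rw [strongDual_pi_apply L]
  congr 3
  rw [← Finset.sum_coe_sort J]
  simp

theorem exists_hasLazyLaplaceLaws :
    ∃ μ : Measure (PrivacyLevel → ℝ), IsProbabilityMeasure μ ∧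
      HasLazyLaplaceLaws (fun e x => x e) μ := by
  choose ν hν hνc using exists_measure_fddChar
  let Q : ∀ J : Finset PrivacyLevel, Measure (∀ _ : J, ℝ) := fun J => (ν J).map J.restrict
  have hQ : ∀ J, IsProbabilityMeasure (Q J) := fun J =>
    Measure.isProbabilityMeasure_map (by fun_prop)
  have hproj : IsProjectiveMeasureFamily (α := fun _ : PrivacyLevel => ℝ) Q := by
    intro I J hJI
    change (ν J).map J.restrict = ((ν I).map I.restrict).map
      (Finset.restrict₂ (π := fun _ : PrivacyLevel => ℝ) hJI)
    have hr : Measurable (Finset.restrict₂ (π := fun _ : PrivacyLevel => ℝ) hJI) :=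
      Finset.measurable_restrict₂ _
    rw [Measure.map_map hr (by fun_prop), Finset.restrict₂_comp_restrict]
    -- Both marginals have characteristic functions given by `fddChar`, with coefficients extended
    -- by zero.
    refine Measure.ext_of_charFunDual ?_
    ext L
    change charFunDual ((ν J).map fun x (e : J) => x e) L =
      charFunDual ((ν I).map fun x (e : J) => x e) L
    rw [charFunDual_map_restrict (X := fun e (x : PrivacyLevel → ℝ) => x e) (fun e => by fun_prop),
      charFunDual_map_restrict (X := fun e (x : PrivacyLevel → ℝ) => x e) (fun e => by fun_prop),
      hνc]
    rw [← fddChar_eq_of_subset hJI fun e _ he => dif_neg he, ← hνc]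
    congr with x
    congr 3
    exact (Finset.sum_subset hJI fun e _ he => by simp [he]).symm
  obtain ⟨μ, hμ, hμQ⟩ := exists_isProjectiveLimit hproj
  refine ⟨μ, hμ, fun e => by fun_prop, fun J c => ?_⟩
  rw [← hνc J c]
  have h : ∀ ξ : Measure (PrivacyLevel → ℝ),
      ∫ x, Complex.exp ((∑ e ∈ J, c e * x e : ℝ) * Complex.I) ∂ξ =
      ∫ y, Complex.exp ((∑ e : J, c e * y e : ℝ) * Complex.I) ∂(ξ.map J.restrict) := by
    intro ξ
    rw [integral_map (by fun_prop) (Measurable.aestronglyMeasurable (by fun_prop))]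
    congr with x
    rw [← Finset.sum_coe_sort]
    rfl
  rw [h, h, hμQ J]

end FiniteDimensionalLaws

/-! ### Independence of increments and the transition law -/

section IndependentIncrements

/-- Coefficients supported on the levels at least `ε` and coefficients of increments from `ε` down
to lower levels contribute independent factors. -/
lemma fddChar_add {K : Finset PrivacyLevel} {ε : PrivacyLevel} {a b : PrivacyLevel → ℝ}
    (ha : ∀ e, e < ε → a e = 0) (hb : ∀ e, ε < e → b e = 0) (hb0 : ∑ e ∈ K, b e = 0) :
    fddChar K (a + b) = fddChar K a * fddChar K b := by
  rw [fddChar, fddChar, fddChar, ← Finset.prod_mul_distrib]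
  refine Finset.prod_congr rfl fun e _ => ?_
  have hsum : ∀ p : PrivacyLevel → Prop, [DecidablePred p] →
      (∀ f, ε < f → p f ∨ b f = 0) → (∀ f ≤ ε, p f) → ∑ f ∈ K with p f, b f = 0 := by
    intro p _ _ h
    rw [← hb0]
    refine Finset.sum_subset (Finset.filter_subset _ _) fun f hf hf' => ?_
    refine hb f (not_le.1 fun hfe => hf' (Finset.mem_filter.2 ⟨hf, h f hfe⟩))
  have hle : ε ≤ e → ∑ f ∈ K with f ≤ e, b f = 0 := fun h =>
    hsum _ (fun f hf => Or.inr (hb f hf)) fun f hf => hf.trans h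
  have hlt : ε < e → ∑ f ∈ K with f < e, b f = 0 := fun h =>
    hsum _ (fun f hf => Or.inr (hb f hf)) fun f hf => hf.trans_lt h
  have hale : e < ε → ∑ f ∈ K with f ≤ e, a f = 0 := fun h =>
    Finset.sum_eq_zero fun f hf => ha f ((Finset.mem_filter.1 hf).2.trans_lt h)
  have halt : e ≤ ε → ∑ f ∈ K with f < e, a f = 0 := fun h =>
    Finset.sum_eq_zero fun f hf => ha f ((Finset.mem_filter.1 hf).2.trans_le h)
  simp only [Pi.add_apply, Finset.sum_add_distrib]
  -- Below ε only `b` contributes and above ε only `a`; at ε itself `a` gives the numerator and `b`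
  -- the denominator.
  rcases lt_trichotomy e ε with h | rfl | h
  · simp [hale h, halt h.le]
  · simp [hle le_rfl, halt le_rfl, div_eq_mul_inv]
  · simp [hle h.le, hlt h]

variable {Ω : Type*} [MeasurableSpace Ω] {P : Measure Ω} {X : PrivacyLevel → Ω → ℝ}

lemma HasLazyLaplaceLaws.integral_cexp_linearCombination (hX : HasLazyLaplaceLaws X P)
    (c : PrivacyLevel →₀ ℝ) {K : Finset PrivacyLevel} (hK : c.support ⊆ K) :
    ∫ ω, Complex.exp ((Finsupp.linearCombination ℝ (fun e => X e ω) c : ℝ) * Complex.I) ∂P =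
      fddChar K c := by
  rw [← hX.integral_cexp]
  congr with ω
  rw [Finsupp.linearCombination_apply, Finsupp.sum_of_support_subset c hK _ (by simp)]
  rfl

lemma HasLazyLaplaceLaws.integral_cexp_add (hX : HasLazyLaplaceLaws X P) {ε : PrivacyLevel}
    {a b : PrivacyLevel →₀ ℝ} (ha : ∀ e, e < ε → a e = 0) (hb : ∀ e, ε < e → b e = 0)
    (hb0 : Finsupp.linearCombination ℝ (fun _ => (1 : ℝ)) b = 0) :
    ∫ ω, Complex.exp ((Finsupp.linearCombination ℝ (fun e => X e ω) (a + b) : ℝ) * Complex.I) ∂P =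
      (∫ ω, Complex.exp ((Finsupp.linearCombination ℝ (fun e => X e ω) a : ℝ) * Complex.I) ∂P) *
      ∫ ω, Complex.exp ((Finsupp.linearCombination ℝ (fun e => X e ω) b : ℝ) * Complex.I) ∂P := by
  have hs : (a + b).support ⊆ a.support ∪ b.support := Finsupp.support_add
  rw [hX.integral_cexp_linearCombination _ hs,
    hX.integral_cexp_linearCombination a Finset.subset_union_left,
    hX.integral_cexp_linearCombination b Finset.subset_union_right, Finsupp.coe_add,
    fddChar_add ha hb]
  rw [Finsupp.linearCombination_apply, Finsupp.sum_of_support_subset b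
    (Finset.subset_union_right (s₁ := a.support)) _ (by simp)] at hb0
  simpa using hb0

/-- The levels at least `ε` of a lazy Laplace process are independent of its increments from `ε`
down to lower levels. -/
theorem HasLazyLaplaceLaws.indepFun_increments [IsProbabilityMeasure P]
    (hX : HasLazyLaplaceLaws X P) (ε : PrivacyLevel) :
    IndepFun (fun ω (s : Set.Ici ε) => X s ω) (fun ω (s : Set.Iic ε) => X s ω - X ε ω) P := by
  have hm := hX.measurable
  refine IndepFun.process_indepFun_process (X := fun (s : Set.Ici ε) ω => X s ω)
    (Y := fun (s : Set.Iic ε) ω => X s ω - X ε ω) (fun _ => hm _) (fun _ => (hm _).sub (hm _))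
    fun I J => ?_
  have hmI : Measurable fun ω (i : I) => X i ω := measurable_pi_lambda _ fun _ => hm _
  have hmJ : Measurable fun ω (j : J) => X j ω - X ε ω :=
    measurable_pi_lambda _ fun _ => (hm _).sub (hm _)
  rw [indepFun_iff_charFunDual_prod hmI.aemeasurable hmJ.aemeasurable]
  intro L
  set L₁ : StrongDual ℝ (I → ℝ) := L.comp (.inl ℝ _ _) with hL₁
  set L₂ : StrongDual ℝ (J → ℝ) := L.comp (.inr ℝ _ _) with hL₂
  classical
  -- A functional of values and increments becomes a combination of values of `X`. In `b`, each
  -- weight at `j` is offset by its negative at ε, so the total weight vanishes.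
  let a : PrivacyLevel →₀ ℝ :=
    ∑ i : I, Finsupp.single (i : PrivacyLevel) (L₁ fun k => if i = k then 1 else 0)
  let b : PrivacyLevel →₀ ℝ :=
    ∑ j : J, (Finsupp.single (j : PrivacyLevel) (L₂ fun k => if j = k then 1 else 0) -
      Finsupp.single ε (L₂ fun k => if j = k then 1 else 0))
  have ha : ∀ e, e < ε → a e = 0 := by
    intro e he
    simp only [a, Finsupp.finsetSum_apply]
    exact Finset.sum_eq_zero fun i _ => Finsupp.single_eq_of_ne (he.trans_le i.1.2).ne
  have hb : ∀ e, ε < e → b e = 0 := by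
    intro e he
    simp only [b, Finsupp.finsetSum_apply, Finsupp.sub_apply]
    refine Finset.sum_eq_zero fun j _ => ?_
    rw [Finsupp.single_eq_of_ne (lt_of_le_of_lt j.1.2 he).ne', Finsupp.single_eq_of_ne he.ne',
      sub_zero]
  have hb0 : Finsupp.linearCombination ℝ (fun _ : PrivacyLevel => (1 : ℝ)) b = 0 := by
    simp [b, map_sum]
  have hLa : ∀ ω, L₁ (fun i : I => X i ω) = Finsupp.linearCombination ℝ (fun e => X e ω) a := by
    intro ω
    rw [strongDual_pi_apply L₁]
    simp [a, map_sum]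
  have hLb : ∀ ω, L₂ (fun j : J => X j ω - X ε ω) =
      Finsupp.linearCombination ℝ (fun e => X e ω) b := by
    intro ω
    rw [strongDual_pi_apply L₂]
    simp [b, map_sum, mul_sub]
  have hL : ∀ ω, L (fun i : I => X i ω, fun j : J => X j ω - X ε ω) =
      Finsupp.linearCombination ℝ (fun e => X e ω) (a + b) := by
    intro ω
    rw [map_add, ← hLa, ← hLb, hL₁, hL₂]
    simp only [ContinuousLinearMap.comp_apply, ← map_add]
    simp
  rw [charFunDual_apply, charFunDual_apply, charFunDual_apply,
    integral_map (hmI.prodMk hmJ).aemeasurable (by fun_prop),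
    integral_map hmI.aemeasurable (by fun_prop), integral_map hmJ.aemeasurable (by fun_prop)]
  simp_rw [hL, hLa, hLb]
  exact hX.integral_cexp_add ha hb hb0

lemma HasLazyLaplaceLaws.map_eq_laplaceMeasure [IsProbabilityMeasure P]
    (hX : HasLazyLaplaceLaws X P) (ε : PrivacyLevel) : P.map (X ε) = laplaceMeasure ε := by
  have := isProbabilityMeasure_laplaceMeasure ε.2
  have hm := hX.measurable ε
  refine Measure.ext_of_charFun ?_
  ext t
  rw [charFun_laplaceMeasure ε.2, charFun_apply_real, integral_map hm.aemeasurable (by fun_prop),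
    ← fddChar_singleton ε (fun _ => t), ← hX.integral_cexp]
  simp

lemma HasLazyLaplaceLaws.indepFun_sub [IsProbabilityMeasure P] (hX : HasLazyLaplaceLaws X P)
    {ε₁ ε₂ : PrivacyLevel} (h : ε₁ ≤ ε₂) : IndepFun (X ε₂) (fun ω => X ε₁ ω - X ε₂ ω) P :=
  (hX.indepFun_increments ε₂).comp 
    (φ := fun x : Set.Ici ε₂ → ℝ => x ⟨ε₂, Set.self_mem_Ici⟩)
    (ψ := fun x : Set.Iic ε₂ → ℝ => x ⟨ε₁, h⟩) (measurable_pi_apply _) (measurable_pi_apply _)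

/-- By independence the increment's characteristic function is the quotient of those of `X ε₁` and
`X ε₂`, the latter nowhere zero. -/
lemma HasLazyLaplaceLaws.map_sub_eq_lazyNoise [IsProbabilityMeasure P]
    (hX : HasLazyLaplaceLaws X P) {ε₁ ε₂ : PrivacyLevel} (h : ε₁ ≤ ε₂) :
    P.map (fun ω => X ε₁ ω - X ε₂ ω) = lazyNoise ε₁ ε₂ := by
  have := isProbabilityMeasure_lazyNoise ε₁.2 h
  have hm₁ := hX.measurable ε₁
  have hm₂ := hX.measurable ε₂
  have hm₃ : Measurable fun ω => X ε₁ ω - X ε₂ ω := hm₁.sub hm₂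
  refine Measure.ext_of_charFun ?_
  ext t
  have key := congrFun ((hX.indepFun_sub h).charFun_map_fun_add_eq_mul
    hm₂.aemeasurable hm₃.aemeasurable) t
  simp only [add_sub_cancel, Pi.mul_apply] at key
  rw [hX.map_eq_laplaceMeasure, hX.map_eq_laplaceMeasure, charFun_laplaceMeasure ε₁.2,
    charFun_laplaceMeasure ε₂.2] at key
  rw [charFun_lazyNoise ε₁.2 h, key, mul_div_cancel_left₀ _ (laplaceChar_ne_zero _)]

/-- The joint law is the image of a product under (y, z) ↦ (y, y + z), hence disintegrates through
the kernel of shifted lazy noise. -/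
lemma HasLazyLaplaceLaws.condDistrib_eq_lazyTransition [IsProbabilityMeasure P]
    (hX : HasLazyLaplaceLaws X P) {ε₁ ε₂ : PrivacyLevel} (h : ε₁ ≤ ε₂) :
    ∀ᵐ y ∂(P.map (X ε₂)), condDistrib (X ε₁) (X ε₂) P y = lazyTransition ε₁ ε₂ y := by
  have := isProbabilityMeasure_lazyNoise ε₁.2 h
  have hm₁ := hX.measurable ε₁
  have hm₂ := hX.measurable ε₂
  have hm₃ : Measurable fun ω => X ε₁ ω - X ε₂ ω := hm₁.sub hm₂
  have := Measure.isProbabilityMeasure_map (μ := P) hm₂.aemeasurable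
  let κ : Kernel ℝ ℝ := (Kernel.id ×ₖ Kernel.const ℝ (lazyNoise ε₁ ε₂)).map fun p => p.1 + p.2
  have hκ : ∀ y, κ y = lazyTransition ε₁ ε₂ y := by
    intro y
    rw [lazyTransition_eq_map, Kernel.map_apply _ (by fun_prop), Kernel.prod_apply,
      Kernel.id_apply, Kernel.const_apply, Measure.dirac_prod, Measure.map_map (by fun_prop)
      (by fun_prop)]
    rfl
  have hκm : IsMarkovKernel κ := Kernel.IsMarkovKernel.map _ (by fun_prop)
  simp_rw [← hκ]
  refine condDistrib_ae_eq_of_measure_eq_compProd (X ε₂) hm₁.aemeasurable ?_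
  have h1 : P.map (fun ω => (X ε₂ ω, X ε₁ ω)) =
      ((P.map (X ε₂)).prod (lazyNoise ε₁ ε₂)).map fun p => (p.1, p.1 + p.2) := by
    rw [← hX.map_sub_eq_lazyNoise h, ← (indepFun_iff_map_prod_eq_prod_map_map hm₂.aemeasurable
      hm₃.aemeasurable).1 (hX.indepFun_sub h),
      Measure.map_map (by fun_prop) (hm₂.prodMk hm₃)]
    congr with ω
    · rfl
    · simp
  rw [h1]
  ext s hs
  rw [Measure.map_apply (by fun_prop) hs, Measure.prod_apply
    ((by fun_prop : Measurable fun p : ℝ × ℝ => (p.1, p.1 + p.2)) hs),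
    Measure.compProd_apply hs]
  congr with y
  rw [hκ, lazyTransition_eq_map, Measure.map_apply (by fun_prop) (measurable_prodMk_left hs)]
  rfl

end IndependentIncrements

lemma HasLazyLaplaceLaws.comp_of_map_eq {Ω Ω' : Type*} [MeasurableSpace Ω]
    [MeasurableSpace Ω'] {P : Measure Ω} {P' : Measure Ω'}
    {X : PrivacyLevel → Ω → ℝ} (hX : HasLazyLaplaceLaws X P) {f : Ω' → Ω} (hf : Measurable f)
    (hfP : P'.map f = P) : HasLazyLaplaceLaws (fun e ω => X e (f ω)) P' where
  measurable e := (hX.measurable e).comp hf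
  integral_cexp J c := by
    have hm := hX.measurable
    rw [← hX.integral_cexp, ← hfP, integral_map hf.aemeasurable
      (Measurable.aestronglyMeasurable (by fun_prop))]

/-! ### The Markov property from independent increments -/

section Markov

/-- If `D` is independent of `Y`, then an event determined by `p Y` and `D` and an event determined
by `Y` are conditionally independent given `p Y`. -/
theorem ProbabilityTheory.IndepFun.condExp_inter_ae_eq_mul {Ω 𝓨 𝓓 𝓧 : Type*}
    {m mΩ : MeasurableSpace Ω} [MeasurableSpace 𝓨] [MeasurableSpace 𝓓] [MeasurableSpace 𝓧]
    {P : Measure Ω} [IsProbabilityMeasure P] {Y : Ω → 𝓨} {D : Ω → 𝓓} {p : 𝓨 → 𝓧}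
    (hY : Measurable Y) (hD : Measurable D) (hp : Measurable p) (hYD : IndepFun Y D P)
    (hm : m = MeasurableSpace.comap (fun ω => p (Y ω)) inferInstance)
    {S : Set (𝓧 × 𝓓)} (hS : MeasurableSet S) {T : Set 𝓨} (hT : MeasurableSet T) :
    let A := (fun ω => (p (Y ω), D ω)) ⁻¹' S
    let B := Y ⁻¹' T
    P⟦A ∩ B | m⟧ =ᵐ[P] P⟦A | m⟧ * P⟦B | m⟧ := by
  intro A B
  have hX : Measurable fun ω => p (Y ω) := hp.comp hY
  have hmΩ : m ≤ mΩ := hm ▸ hX.comap_le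
  have hA : MeasurableSet A := (hX.prodMk hD) hS
  have hB : MeasurableSet B := hY hT
  have := Measure.isProbabilityMeasure_map (μ := P) hD.aemeasurable
  -- By Fubini, φ(p(Y)) is the conditional probability of `A` given all of `Y`; it depends on `p Y`
  -- alone, which is the point.
  let φ : 𝓧 → ℝ := fun x => (P.map D).real (Prod.mk x ⁻¹' S)
  have hφ : Measurable φ := (measurable_measure_prodMk_left hS).ennreal_toReal
  have hφX : Measurable fun ω => φ (p (Y ω)) := hφ.comp hX
  have hφm : StronglyMeasurable[m] fun ω => φ (p (Y ω)) :=
    (hφ.comp (hm ▸ comap_measurable fun ω => p (Y ω))).stronglyMeasurable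
  have hφ1 : ∀ x, ‖φ x‖ ≤ 1 := fun x => by
    rw [Real.norm_of_nonneg measureReal_nonneg]
    exact measureReal_le_one
  have hint : Integrable (fun ω => φ (p (Y ω))) P :=
    Integrable.of_bound hφX.aestronglyMeasurable 1 (Eventually.of_forall fun ω => hφ1 _)
  have hprod := (indepFun_iff_map_prod_eq_prod_map_map hY.aemeasurable hD.aemeasurable).1 hYD
  have key : ∀ T' : Set 𝓨, MeasurableSet T' →
      P.real (A ∩ Y ⁻¹' T') = ∫ ω in Y ⁻¹' T', φ (p (Y ω)) ∂P := by
    intro T' hT'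
    have hU : MeasurableSet {q : 𝓨 × 𝓓 | (p q.1, q.2) ∈ S ∧ q.1 ∈ T'} :=
      (((hp.comp measurable_fst).prodMk measurable_snd) hS).inter (measurable_fst hT')
    have h1 : P (A ∩ Y ⁻¹' T') = ∫⁻ ω in Y ⁻¹' T', P.map D (Prod.mk (p (Y ω)) ⁻¹' S) ∂P := by
      have h2 : A ∩ Y ⁻¹' T' =
          (fun ω => (Y ω, D ω)) ⁻¹' {q : 𝓨 × 𝓓 | (p q.1, q.2) ∈ S ∧ q.1 ∈ T'} := rfl
      rw [h2, ← Measure.map_apply (hY.prodMk hD) hU, hprod, Measure.prod_apply hU,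
        lintegral_map (measurable_measure_prodMk_left hU) hY,
        ← lintegral_indicator (hY hT')]
      congr with ω
      by_cases hω : Y ω ∈ T' <;> simp [hω, indicator, preimage]
    rw [measureReal_def, h1, integral_eq_lintegral_of_nonneg_ae
      (Eventually.of_forall fun _ => measureReal_nonneg) hφX.aestronglyMeasurable]
    simp
  have hmeasE : ∀ E, MeasurableSet[m] E → ∃ T', MeasurableSet T' ∧ Y ⁻¹' T' = E := by
    subst hm
    rintro _ ⟨U, hU, rfl⟩
    exact ⟨p ⁻¹' U, hp hU, rfl⟩
  have hindic : ∀ C : Set Ω, MeasurableSet C → Integrable (C.indicator fun _ => (1 : ℝ)) P :=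
    fun C hC => (integrable_const 1).indicator hC
  have hcondA : (fun ω => φ (p (Y ω))) =ᵐ[P] P⟦A | m⟧ := by
    refine ae_eq_condExp_of_forall_setIntegral_eq hmΩ (hindic A hA) (fun _ _ _ => hint.integrableOn)
      (fun E hE _ => ?_) hφm.aestronglyMeasurable
    obtain ⟨T', hT', rfl⟩ := hmeasE E hE
    rw [← key T' hT', integral_indicator_const _ hA]
    simp [measureReal_restrict_apply hA]
  have hmul : Integrable ((fun ω => φ (p (Y ω))) * B.indicator fun _ => (1 : ℝ)) P := by
    refine Integrable.of_bound (hφX.mul (measurable_const.indicator hB)).aestronglyMeasurable 1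
      (Eventually.of_forall fun ω => ?_)
    by_cases hω : ω ∈ B <;> simp [hω, hφ1 (p (Y ω)), -Real.norm_eq_abs]
  have hcondAB : P[(fun ω => φ (p (Y ω))) * B.indicator (fun _ => (1 : ℝ)) | m] =ᵐ[P]
      P⟦A ∩ B | m⟧ := by
    refine ae_eq_condExp_of_forall_setIntegral_eq hmΩ (hindic _ (hA.inter hB))
      (fun _ _ _ => integrable_condExp.integrableOn) (fun E hE _ => ?_)
      stronglyMeasurable_condExp.aestronglyMeasurable
    rw [setIntegral_condExp hmΩ hmul hE]
    obtain ⟨T', hT', rfl⟩ := hmeasE E hE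
    rw [integral_indicator_const _ (hA.inter hB)]
    have h3 : ((fun ω => φ (p (Y ω))) * B.indicator fun _ => (1 : ℝ)) =
        B.indicator fun ω => φ (p (Y ω)) := by
      ext ω
      by_cases hω : ω ∈ B <;> simp [hω]
    rw [h3, setIntegral_indicator hB, ← preimage_inter, ← key _ (hT'.inter hT),
      measureReal_restrict_apply (hA.inter hB)]
    simp only [smul_eq_mul, mul_one]
    congr 1
    ext ω
    simp only [preimage_inter, mem_inter_iff, B]
    tauto
  calc P⟦A ∩ B | m⟧ =ᵐ[P] P[(fun ω => φ (p (Y ω))) * B.indicator (fun _ => (1 : ℝ)) | m] :=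
        hcondAB.symm
    _ =ᵐ[P] (fun ω => φ (p (Y ω))) * P⟦B | m⟧ :=
        condExp_mul_of_stronglyMeasurable_left hφm hmul (hindic B hB)
    _ =ᵐ[P] P⟦A | m⟧ * P⟦B | m⟧ := hcondA.mul EventuallyEq.rfl

variable {Ω : Type*} [MeasurableSpace Ω] {P : Measure Ω} [IsProbabilityMeasure P]

/-- The past at levels ≤ t is recovered from `X t` and the increments below `t`, which are
independent of the path at levels ≥ t. -/
theorem HasLazyLaplaceLaws.isMarkovProcess {X : PrivacyLevel → Ω → ℝ}
    (hX : HasLazyLaplaceLaws X P) : IsMarkovProcess X P := by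
  intro t A B hA hB
  have hm := hX.measurable
  have hY : Measurable fun ω (s : Set.Ici t) => X s ω := measurable_pi_lambda _ fun _ => hm _
  have hD : Measurable fun ω (s : Set.Iic t) => X s ω - X t ω :=
    measurable_pi_lambda _ fun _ => (hm _).sub (hm _)
  have hfuture : (⨆ s : Set.Ici t, MeasurableSpace.comap (X s) inferInstance) ≤
      MeasurableSpace.comap (fun ω (s : Set.Ici t) => X s ω) inferInstance :=
    iSup_le fun s => Measurable.comap_le
      ((measurable_pi_apply s).comp (comap_measurable fun ω (s : Set.Ici t) => X s ω))
  have hpast : (⨆ s : Set.Iic t, MeasurableSpace.comap (X s) inferInstance) ≤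
      MeasurableSpace.comap (fun ω => (X t ω, fun s : Set.Iic t => X s ω - X t ω))
        inferInstance := by
    refine iSup_le fun s => ?_
    have h1 : Measurable fun q : ℝ × (Set.Iic t → ℝ) => q.1 + q.2 s := by fun_prop
    have h2 := h1.comp (comap_measurable fun ω => (X t ω, fun s : Set.Iic t => X s ω - X t ω))
    have h3 : (fun q : ℝ × (Set.Iic t → ℝ) => q.1 + q.2 s) ∘
        (fun ω => (X t ω, fun s : Set.Iic t => X s ω - X t ω)) = X s := by
      ext ω
      simp
    rw [h3] at h2
    exact h2.comap_le
  obtain ⟨S, hS, rfl⟩ := hpast A hA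
  obtain ⟨T, hT, rfl⟩ := hfuture B hB
  exact (hX.indepFun_increments t).condExp_inter_ae_eq_mul hY hD
    (p := fun y : Set.Ici t → ℝ => y ⟨t, Set.self_mem_Ici⟩) (measurable_pi_apply _) rfl hS hT

theorem HasLazyLaplaceLaws.isLazyLaplace {X : PrivacyLevel → Ω → ℝ}
    (hX : HasLazyLaplaceLaws X P) : IsLazyLaplaceProcess X P where
  measurable := hX.measurable
  markov := hX.isMarkovProcess
  laplace := hX.map_eq_laplaceMeasure
  lazy_transition _ _ h := hX.condDistrib_eq_lazyTransition h

end Markov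

/-! ### Privacy as domination of measures -/

section Privacy

variable {U Y Z : Type*} [MetricSpace U] [MeasurableSpace Y] [MeasurableSpace Z] {ε : ℝ}

lemma isLipschitzPrivate_of_le (hε : 0 ≤ ε) {Q : U → Measure Y}
    (hQ : ∀ u, IsProbabilityMeasure (Q u))
    (h : ∀ u u', Q u ≤ ENNReal.ofReal (Real.exp (ε * dist u u')) • Q u') :
    IsLipschitzPrivate ε Q := by
  have h0 : ∀ u u' S, Q u' S = 0 → Q u S = 0 := fun u u' S hS => by
    have := h u u' S
    simpa [hS] using this
  have hlog : ∀ u u' S, Q u S ≠ 0 →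
      Real.log ((Q u).real S) - Real.log ((Q u').real S) ≤ ε * dist u u' := by
    intro u u' S hS
    have hS' : Q u' S ≠ 0 := fun h' => hS (h0 u u' S h')
    have hpos : 0 < (Q u).real S := ENNReal.toReal_pos hS (measure_ne_top _ _)
    have hpos' : 0 < (Q u').real S := ENNReal.toReal_pos hS' (measure_ne_top _ _)
    have hle : (Q u).real S ≤ Real.exp (ε * dist u u') * (Q u').real S := by
      have := ENNReal.toReal_mono (by
        rw [Measure.smul_apply, smul_eq_mul]
        finiteness) (h u u' S)
      simpa [measureReal_def, ENNReal.toReal_ofReal (Real.exp_pos _).le] using this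
    have := Real.log_le_log hpos hle
    rw [Real.log_mul (Real.exp_pos _).ne' hpos'.ne', Real.log_exp] at this
    linarith
  refine ⟨hQ, fun u u' S _ => ⟨⟨h0 u' u S, h0 u u' S⟩, ?_⟩⟩
  by_cases hS : Q u S = 0
  · simp only [measureReal_def, hS, h0 u' u S hS, sub_self, abs_zero]
    positivity
  · refine abs_le.2 ⟨?_, hlog u u' S hS⟩
    have := hlog u' u S (fun h' => hS (h0 u u' S h'))
    rw [dist_comm] at this
    linarith

lemma IsLipschitzPrivate.measure_le {Q : U → Measure Y} (h : IsLipschitzPrivate ε Q) (u u' : U)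
    {S : Set Y} (hS : MeasurableSet S) :
    Q u S ≤ ENNReal.ofReal (Real.exp (ε * dist u u')) * Q u' S := by
  have := h.1
  obtain ⟨h0, hlog⟩ := h.2 u u' S hS
  by_cases hS0 : Q u S = 0
  · simp [hS0]
  have hpos : 0 < (Q u).real S := ENNReal.toReal_pos hS0 (measure_ne_top _ _)
  have hpos' : 0 < (Q u').real S :=
    ENNReal.toReal_pos (fun h' => hS0 (h0.2 h')) (measure_ne_top _ _)
  rw [← ofReal_measureReal, ← ofReal_measureReal, ← ENNReal.ofReal_mul (Real.exp_pos _).le]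
  refine ENNReal.ofReal_le_ofReal ?_
  rw [← Real.exp_log hpos, ← Real.exp_log hpos', ← Real.exp_add, Real.exp_le_exp]
  linarith [(abs_le.1 hlog).2]

/-- Post-processing preserves privacy. -/
lemma IsLipschitzPrivate.map {Q : U → Measure Y} (h : IsLipschitzPrivate ε Q) {f : Y → Z}
    (hf : Measurable f) : IsLipschitzPrivate ε fun u => (Q u).map f := by
  have := h.1
  refine ⟨fun u => Measure.isProbabilityMeasure_map hf.aemeasurable, fun u u' S hS => ?_⟩
  simp only [map_measureReal_apply hf hS, Measure.map_apply hf hS]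
  exact h.2 u u' _ (hf hS)

/-- The product outer measure is the largest one bounded by the product on boxes, so a comparison on
boxes suffices once the constant is divided out. -/
lemma pi_le_prod_smul_pi {ι : Type*} [Fintype ι] {α : ι → Type*} [∀ i, MeasurableSpace (α i)]
    {μ ν : ∀ i, Measure (α i)} [∀ i, SigmaFinite (μ i)] [∀ i, SigmaFinite (ν i)] {c : ι → ℝ≥0∞}
    (hc0 : ∀ i, c i ≠ 0) (hc : ∀ i, c i ≠ ∞) (h : ∀ i, μ i ≤ c i • ν i) :
    Measure.pi μ ≤ (∏ i, c i) • Measure.pi ν := by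
  have hC0 : ∏ i, c i ≠ 0 := Finset.prod_ne_zero_iff.2 fun i _ => hc0 i
  have hC : ∏ i, c i ≠ ∞ := ENNReal.prod_ne_top fun i _ => hc i
  have key : (∏ i, c i)⁻¹ • (Measure.pi μ).toOuterMeasure ≤
      OuterMeasure.pi fun i => (ν i).toOuterMeasure := by
    refine OuterMeasure.le_pi.2 fun s _ => ?_
    rw [smul_apply, smul_eq_mul, Measure.coe_toOuterMeasure, Measure.pi_pi,
      ENNReal.inv_mul_le_iff hC0 hC, ← Finset.prod_mul_distrib]
    exact Finset.prod_le_prod' fun i _ => h i (s i)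
  refine Measure.le_iff.2 fun s hs => ?_
  have := key s
  rw [smul_apply, smul_eq_mul, Measure.coe_toOuterMeasure,
    ENNReal.inv_mul_le_iff hC0 hC] at this
  rw [Measure.smul_apply, smul_eq_mul]
  convert this using 2
  rw [Measure.pi, toMeasure_apply _ _ hs]

variable {Ω : Type*} [MeasurableSpace Ω] {P : Measure Ω} [IsProbabilityMeasure P]
  {X : PrivacyLevel → Ω → ℝ}

/-- The shifted path is a fixed function of u + X_ε and of independent increments whose law does not
involve `u`, so the Laplace bound at level ε carries over. -/
lemma HasLazyLaplaceLaws.map_const_add_path_le (hX : HasLazyLaplaceLaws X P) (ε : PrivacyLevel)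
    (u u' : ℝ) :
    P.map (fun ω (σ : Set.Iic ε) => u + X σ ω) ≤
      ENNReal.ofReal (Real.exp (ε * |u - u'|)) • P.map fun ω (σ : Set.Iic ε) => u' + X σ ω := by
  have hm := hX.measurable
  have := isProbabilityMeasure_laplaceMeasure ε.2
  have hD : Measurable fun ω (s : Set.Iic ε) => X s ω - X ε ω :=
    measurable_pi_lambda _ fun _ => (hm _).sub (hm _)
  have hind : IndepFun (X ε) (fun ω (s : Set.Iic ε) => X s ω - X ε ω) P :=
    (hX.indepFun_increments ε).comp
      (φ := fun x : Set.Ici ε → ℝ => x ⟨ε, Set.self_mem_Ici⟩) (ψ := id)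
      (measurable_pi_apply _) measurable_id
  have hprod := (indepFun_iff_map_prod_eq_prod_map_map (hm ε).aemeasurable hD.aemeasurable).1 hind
  rw [hX.map_eq_laplaceMeasure] at hprod
  set ν := P.map fun ω (s : Set.Iic ε) => X s ω - X ε ω
  have : IsProbabilityMeasure ν := Measure.isProbabilityMeasure_map hD.aemeasurable
  have hF : Measurable fun (q : ℝ × (Set.Iic ε → ℝ)) (σ : Set.Iic ε) => q.1 + q.2 σ := by fun_prop
  have hpath : ∀ u : ℝ, P.map (fun ω (σ : Set.Iic ε) => u + X σ ω) =
      (((laplaceMeasure ε).map fun x => u + x).prod ν).map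
        fun (q : ℝ × (Set.Iic ε → ℝ)) (σ : Set.Iic ε) => q.1 + q.2 σ := by
    intro u
    have h1 : ((laplaceMeasure ε).map fun x => u + x).prod ν =
        ((laplaceMeasure ε).prod ν).map (Prod.map (fun x => u + x) id) := by
      rw [← Measure.map_prod_map _ _ (by fun_prop) measurable_id, Measure.map_id]
    rw [h1, ← hprod, Measure.map_map hF (by fun_prop), Measure.map_map (by fun_prop)
      ((hm ε).prodMk hD)]
    congr with ω σ
    simp [add_assoc]
  rw [hpath, hpath]
  set c := ENNReal.ofReal (Real.exp (ε * |u - u'|))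
  calc (((laplaceMeasure ε).map fun x => u + x).prod ν).map _
      ≤ ((c • (laplaceMeasure ε).map fun x => u' + x).prod ν).map _ :=
        Measure.map_mono (Measure.prod_mono (map_const_add_laplaceMeasure_le ε.2 u u') le_rfl) hF
    _ = _ := by rw [Measure.prod_smul_left, Measure.map_smul]

end Privacy

/-! ### Independent copies and privacy in ℝⁿ -/

section ProductProcess

/-- The process in `ℝⁿ` on the product space `(ℝ^(0,∞))ⁿ` whose coordinates are the coordinate
processes of the factors. -/
def productProcess (n : ℕ) (ε : PrivacyLevel) (ω : Fin n → PrivacyLevel → ℝ) : PrivateData n :=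
  WithLp.toLp 1 fun i => ω i ε

variable {n : ℕ}

lemma measurable_productProcess (ε : PrivacyLevel) : Measurable (productProcess n ε) := by
  unfold productProcess
  fun_prop

variable {μ : Measure (PrivacyLevel → ℝ)} [IsProbabilityMeasure μ]

theorem isLipschitzPrivate_path (hμ : HasLazyLaplaceLaws (fun e x => x e) μ) (ε : PrivacyLevel) :
    IsLipschitzPrivate (ε : ℝ) fun u : PrivateData n => (Measure.pi fun _ : Fin n => μ).map
      fun ω (σ : Set.Iic ε) => u + productProcess n σ ω := by
  have hpath : ∀ u : PrivateData n, Measurable fun ω (σ : Set.Iic ε) =>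
      u + productProcess n σ ω := fun u =>
    measurable_pi_lambda _ fun σ => (measurable_productProcess _).const_add u
  have hΦ : Measurable fun (z : Fin n → Set.Iic ε → ℝ) (σ : Set.Iic ε) =>
      (WithLp.toLp 1 fun i => z i σ : PrivateData n) :=
    measurable_pi_lambda _ fun σ => by fun_prop
  have h1 : ∀ u : ℝ, Measurable fun (x : PrivacyLevel → ℝ) (σ : Set.Iic ε) => u + x σ := by
    fun_prop
  have hmap : ∀ u : PrivateData n, (Measure.pi fun _ : Fin n => μ).map
      (fun ω (σ : Set.Iic ε) => u + productProcess n σ ω) =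
      (Measure.pi fun i => μ.map fun (x : PrivacyLevel → ℝ) (σ : Set.Iic ε) => u i + x σ).map
        fun z σ => WithLp.toLp 1 fun i => z i σ := by
    intro u
    have : ∀ i, IsProbabilityMeasure
        (μ.map fun (x : PrivacyLevel → ℝ) (σ : Set.Iic ε) => u i + x σ) :=
      fun i => Measure.isProbabilityMeasure_map (h1 _).aemeasurable
    rw [← Measure.pi_map_pi (fun i => (h1 (u i)).aemeasurable),
      Measure.map_map hΦ (by fun_prop)]
    rfl
  refine isLipschitzPrivate_of_le (le_of_lt ε.2)
    (fun u => Measure.isProbabilityMeasure_map (hpath u).aemeasurable) fun u u' => ?_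
  rw [hmap, hmap, ← Measure.map_smul]
  refine Measure.map_mono ?_ hΦ
  have hp : ∀ (v : PrivateData n) (i : Fin n), IsProbabilityMeasure
      (μ.map fun (x : PrivacyLevel → ℝ) (σ : Set.Iic ε) => v i + x σ) :=
    fun v i => Measure.isProbabilityMeasure_map (h1 _).aemeasurable
  have hu := hp u
  have hu' := hp u'
  convert pi_le_prod_smul_pi (c := fun i => ENNReal.ofReal (Real.exp (ε * |u i - u' i|)))
    (fun i => by simp [Real.exp_pos]) (fun i => ENNReal.ofReal_ne_top)
    (fun i => hμ.map_const_add_path_le ε (u i) (u' i)) using 2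
  -- The coordinate factors multiply to exp(ε ∑ |uᵢ - u'ᵢ|), which is where the ℓ₁ metric enters.
  rw [← ENNReal.ofReal_prod_of_nonneg fun _ _ => (Real.exp_pos _).le, ← Real.exp_sum,
    ← Finset.mul_sum, PiLp.dist_eq_of_L1]
  rfl

theorem isLipschitzPrivate_additiveMechanism (hμ : HasLazyLaplaceLaws (fun e x => x e) μ)
    (ε : PrivacyLevel) : IsLipschitzPrivate (ε : ℝ)
      (additiveMechanism ((Measure.pi fun _ : Fin n => μ).map (productProcess n ε))) := by
  have h := (isLipschitzPrivate_path (n := n) hμ ε).map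
    (measurable_pi_apply (⟨ε, Set.self_mem_Iic⟩ : Set.Iic ε))
  convert h using 2 with u
  rw [additiveMechanism, Measure.map_map (by fun_prop) (measurable_productProcess ε),
    Measure.map_map (measurable_pi_apply _)
      (measurable_pi_lambda _ fun σ => (measurable_productProcess _).const_add u)]
  rfl

end ProductProcess

/-! ### Optimality of Laplace noise among additive mechanisms -/

section Optimality

variable {n : ℕ} {ε : ℝ}

lemma meanSquaredError_eq_sum (g : Measure (PrivateData n)) :
    meanSquaredError g = ∑ i, ∫⁻ x, ENNReal.ofReal (x ^ 2) ∂(g.map fun v => v i) := by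
  rw [meanSquaredError]
  simp_rw [ENNReal.ofReal_sum_of_nonneg fun (i : Fin n) _ => sq_nonneg _]
  rw [lintegral_finsetSum _ fun i _ => by fun_prop]
  refine Finset.sum_congr rfl fun i _ => ?_
  rw [lintegral_map (by fun_prop) (by fun_prop)]

/-- Each coordinate of private additive noise has heavier tails than Laplace noise. -/
lemma IsLipschitzPrivate.exp_neg_le_measure_le_abs {g : Measure (PrivateData n)}
    (hg : IsLipschitzPrivate ε (additiveMechanism g)) (i : Fin n) {r : ℝ} (hr : 0 ≤ r) :
    ENNReal.ofReal (Real.exp (-(ε * r))) ≤ g {v | r ≤ |v i|} := by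
  have hgp : IsProbabilityMeasure g := by
    have := hg.1 0
    simpa [additiveMechanism] using this
  have hshift : ∀ (a : ℝ) (S : Set ℝ), MeasurableSet S →
      g {v | v i ∈ S} ≤ ENNReal.ofReal (Real.exp (ε * |a|)) * g {v | a + v i ∈ S} := by
    intro a S hS
    have hm : Measurable fun v : PrivateData n => v i := by fun_prop
    have h := hg.measure_le 0 (WithLp.toLp 1 (Pi.single i a)) (hm hS)
    rw [additiveMechanism, additiveMechanism, Measure.map_apply (by fun_prop) (hm hS),
      Measure.map_apply (by fun_prop) (hm hS)] at h
    have hd : dist (0 : PrivateData n) (WithLp.toLp 1 (Pi.single i a)) = |a| := by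
      rw [PiLp.dist_eq_of_L1, Finset.sum_eq_single i]
      · simp
      · intro j _ hj
        simp [hj]
      · simp
    rw [hd] at h
    convert h using 3
    · ext v
      simp
    · ext v
      simp
  have hexp : ENNReal.ofReal (Real.exp (-(ε * r))) * ENNReal.ofReal (Real.exp (ε * r)) = 1 := by
    rw [← ENNReal.ofReal_mul (Real.exp_pos _).le, ← Real.exp_add]
    simp
  -- The half-lines at 0 partition the line. Moving each a distance `r` outward costs a factor
  -- exp(εr) and lands in {|vᵢ| ≥ r}.
  have h1 := hshift (-r) (Ici 0) measurableSet_Ici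
  have h2 := hshift r (Iio 0) measurableSet_Iio
  rw [abs_neg, abs_of_nonneg hr] at h1
  rw [abs_of_nonneg hr] at h2
  have hone : 1 = g {v | v i ∈ Ici (0 : ℝ)} + g {v | v i ∈ Iio (0 : ℝ)} := by
    have hm : MeasurableSet {v : PrivateData n | v i ∈ Iio (0 : ℝ)} :=
      (by fun_prop : Measurable fun v : PrivateData n => v i) measurableSet_Iio
    refine (measure_univ (μ := g)).symm.trans ?_
    rw [← measure_union _ hm]
    · congr 1
      ext v
      simp [le_or_gt]
    · refine Set.disjoint_left.2 fun v hv hv' => ?_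
      exact not_lt_of_ge (show 0 ≤ v i from hv) hv'
  have hsum : g {v | -r + v i ∈ Ici (0 : ℝ)} + g {v | r + v i ∈ Iio (0 : ℝ)} ≤
      g {v | r ≤ |v i|} := by
    rw [← measure_union]
    · refine measure_mono ?_
      rintro v (hv | hv)
      · have : 0 ≤ -r + v i := hv
        exact (show r ≤ |v i| from le_abs.2 (Or.inl (by linarith)))
      · have : r + v i < 0 := hv
        exact (show r ≤ |v i| from le_abs.2 (Or.inr (by linarith)))
    · refine Set.disjoint_left.2 fun v hv hv' => ?_
      have h3 : 0 ≤ -r + v i := hv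
      have h4 : r + v i < 0 := hv'
      linarith
    · exact (by fun_prop : Measurable fun v : PrivateData n => r + v i) measurableSet_Iio
  calc ENNReal.ofReal (Real.exp (-(ε * r)))
      ≤ ENNReal.ofReal (Real.exp (-(ε * r))) * (ENNReal.ofReal (Real.exp (ε * r)) *
          (g {v | -r + v i ∈ Ici (0 : ℝ)} + g {v | r + v i ∈ Iio (0 : ℝ)})) := by
        refine le_mul_of_one_le_right' ?_
        rw [mul_add]
        exact hone.le.trans (add_le_add h1 h2)
    _ = g {v | -r + v i ∈ Ici (0 : ℝ)} + g {v | r + v i ∈ Iio (0 : ℝ)} := by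
        rw [← mul_assoc, hexp, one_mul]
    _ ≤ _ := hsum

/-- Each coordinate of private additive noise has at least the second moment of Laplace noise. -/
lemma IsLipschitzPrivate.lintegral_sq_laplaceMeasure_le (hε : 0 < ε) {g : Measure (PrivateData n)}
    (hg : IsLipschitzPrivate ε (additiveMechanism g)) (i : Fin n) :
    ∫⁻ x, ENNReal.ofReal (x ^ 2) ∂(laplaceMeasure ε) ≤
      ∫⁻ x, ENNReal.ofReal (x ^ 2) ∂(g.map fun v => v i) := by
  have := isProbabilityMeasure_laplaceMeasure hε
  have hgp : IsProbabilityMeasure g := by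
    have := hg.1 0
    simpa [additiveMechanism] using this
  rw [lintegral_sq_eq_lintegral_tail, lintegral_sq_eq_lintegral_tail]
  refine setLIntegral_mono' measurableSet_Ioi fun t ht => ?_
  refine mul_le_mul_left ?_ _
  rw [laplaceMeasure_le_abs hε (mem_Ioi.1 ht).le, Measure.map_apply (by fun_prop)
    (measurableSet_le measurable_const (by fun_prop))]
  exact hg.exp_neg_le_measure_le_abs i (mem_Ioi.1 ht).le

variable {μ : Measure (PrivacyLevel → ℝ)} [IsProbabilityMeasure μ]

/-- The squared error is a sum over coordinates, so only the marginals matter, and Laplace marginals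
minimize every term. -/
theorem isOptimalPrivateNoise_productProcess (hμ : HasLazyLaplaceLaws (fun e x => x e) μ)
    (ε : PrivacyLevel) : IsOptimalPrivateNoise (ε : ℝ)
      ((Measure.pi fun _ : Fin n => μ).map (productProcess n ε)) := by
  refine ⟨isLipschitzPrivate_additiveMechanism hμ ε, fun g hg => ?_⟩
  rw [meanSquaredError_eq_sum, meanSquaredError_eq_sum]
  refine Finset.sum_le_sum fun i _ => ?_
  have hcoord : ((Measure.pi fun _ : Fin n => μ).map (productProcess n ε)).map (fun v => v i) =
      laplaceMeasure ε := by
    rw [Measure.map_map (by fun_prop) (measurable_productProcess ε),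
      ← hμ.map_eq_laplaceMeasure ε]
    conv_rhs => rw [← (measurePreserving_eval (fun _ : Fin n => μ) i).map_eq]
    rw [Measure.map_map (by fun_prop) (by fun_prop)]
    rfl
  rw [hcoord]
  exact hg.lintegral_sq_laplaceMeasure_le ε.2 i

end Optimality

/-! ### The main theorem -/

theorem theoremB (n : ℕ) :
    ∃ (Ω : Type) (_ : MeasurableSpace Ω) (P : Measure Ω) (_ : IsProbabilityMeasure P)
      (V : PrivacyLevel → Ω → PrivateData n),
      (∀ ε, Measurable (V ε)) ∧
      -- the coordinates are independent, identically distributed processes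
      iIndepFun (fun (i : Fin n) (ω : Ω) (ε : PrivacyLevel) => V ε ω i) P ∧
      (∀ i j : Fin n, IdentDistrib (fun (ω : Ω) (ε : PrivacyLevel) => V ε ω i)
        (fun (ω : Ω) (ε : PrivacyLevel) => V ε ω j) P P) ∧
      -- each coordinate is a lazy Markov process with Laplace marginals
      (∀ i : Fin n, IsLazyLaplaceProcess (fun ε ω => V ε ω i) P) ∧
      -- privacy: releasing the path of `u + V` over the levels in `(0, ε]` is `ε`-private
      (∀ ε : PrivacyLevel, IsLipschitzPrivate (ε : ℝ) (fun u : PrivateData n =>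
        P.map (fun (ω : Ω) (σ : Set.Iic ε) => u + V σ ω))) ∧
      -- accuracy: `u + V ε` is an optimal `ε`-private mechanism
      (∀ ε : PrivacyLevel, IsOptimalPrivateNoise (ε : ℝ) (P.map (V ε))) := by
  obtain ⟨μ, hμp, hμ⟩ := exists_hasLazyLaplaceLaws
  have heval : ∀ i : Fin n, (Measure.pi fun _ : Fin n => μ).map (Function.eval i) = μ := fun i =>
    (measurePreserving_eval (fun _ : Fin n => μ) i).map_eq
  refine ⟨Fin n → PrivacyLevel → ℝ, inferInstance, Measure.pi fun _ => μ, inferInstance,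
    productProcess n, measurable_productProcess, ?_, fun i j => ?_, fun i => ?_,
    isLipschitzPrivate_path hμ, isOptimalPrivateNoise_productProcess hμ⟩
  · exact iIndepFun_pi (X := fun (_ : Fin n) (x : PrivacyLevel → ℝ) => x)
      fun _ => aemeasurable_id
  · exact ⟨(measurable_pi_apply i).aemeasurable, (measurable_pi_apply j).aemeasurable,
      (heval i).trans (heval j).symm⟩
  · exact (hμ.comp_of_map_eq (measurable_pi_apply i) (heval i)).isLazyLaplace
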